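/- **Setting.** Let $d$ be a natural number and let $H$ be a reproducing kernel Hilbert space of vector fields $\mathbb R^d\to\mathbb R^d$ with matrix-valued kernel $K$, such that * $K$ is $\mathcal C^2$ in its first argument; * for some constant $N_K$, $K_{ii}(u,u)-2K_{ii}(u,v)+K_{ii}(v,v)\le N_K^2|u-v|^2$ for all $u,v\in\mathbb R^d$ and $i=1,\dots,d$. For $f\in H$, $x_0\in\mathbb R^d$ and a step $h>0$, let $z_0=x_0$, $z_{l+1}=z_l+hf(z_l)$ be the Euler iterates and let $\tilde x(x_0,f,h,\cdot)$ be the function on $[0,\infty)$ that interpolates linearly between the points $(lh,z_l)$, $l\ge 0$. Let $R,r,M_\epsilon\ge 0$, $T>0$, and let $f_0\in H$. Let $x^*:[0,T]\to\mathbb R^d$ satisfy $x^*(0)=x_0^*$ and $\dot x^*(t)=f^*(x^*(t))$ for $0\le t\le T$, where $f^*\in H$, $\|f^*-f_0\|_H\le R$ and $|x_0^*|\le r$. Let $0\le t_1\le\dots\le t_m\le t_{m+1}=T$ and let $y_j=x^*(t_j)+\epsilon_j$, $j=1,\dots,m$, where the $\epsilon_j$ are independent $\mathbb R^d$-valued random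 variables with mean zero and $|\epsilon_j|\le M_\epsilon$ almost surely. Almost surely, let $(\hat f,\hat x_0)$ be a minimizer of $$\sum_{j=1}^m (t_{j+1}-t_j)\,|\tilde x(x_0,f,h,t_j)-y_j|^2$$ over all $(f,x_0)\in H\times\mathbb R^d$ with $\|f-f_0\|_H\le R$ and $|x_0|\le r$, and put $$L(\hat f,\hat x_0)=\sum_{j=1}^m (t_{j+1}-t_j)\,|\tilde x(\hat x_0,\hat f,h,t_j)-x^*(t_j)|^2 .$$ **Theorem.** There are positive constants $K_2,L_{12},L_{13}$, depending only on $R$, $r$, $T$, $M_\epsilon$, the kernel $K$ (hence on $d$) and an upper bound $\rho$ for $\|f_0\|_H$ (so on nothing more than $R,r,T,M_\epsilon,K$ when $f_0=0$), such that for every $\epsilon>0$ $$\mathbb P\Big(L(\hat f,\hat x_0)\ \ge\ L_{13}\sqrt{\textstyle\sum_{j=1}^m (t_{j+1}-t_j)^2}+h^2L_{12}+\epsilon\Big)\ \le\ \exp\Big(\frac{-2\epsilon^2}{K_2^2\sum_{j=1}^m (t_{j+1}-t_j)^2}\Big).$$ (If $\sum_j(t_{j+1}-t_j)^2=0$, the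 right-hand side is read as $1$. If the event is not measurable, $\mathbb P$ is the outer measure.) -/

import Mathlib

open MeasureTheory ProbabilityTheory

noncomputable section

section Kernel

variable {d : ℕ} (H : Type*) [NormedAddCommGroup H] [InnerProductSpace ℝ H] [CompleteSpace H]
  [RKHS ℝ H (EuclideanSpace ℝ (Fin d)) (EuclideanSpace ℝ (Fin d))]

/-- The entry `K_{ij}(x, y) = e_iᵀ K(x, y) e_j` of the matrix-valued reproducing kernel of `H`. -/
def kernelEntry (i j : Fin d) (x y : EuclideanSpace ℝ (Fin d)) : ℝ :=
  inner ℝ (EuclideanSpace.single i (1 : ℝ))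
    (RKHS.kernel H x y (EuclideanSpace.single j (1 : ℝ)))

/-- The kernel is `C²` in its first argument. -/
def KernelC2 : Prop :=
  ∀ (i j : Fin d) (y : EuclideanSpace ℝ (Fin d)), ContDiff ℝ 2 fun x => kernelEntry H i j x y

/-- The kernel distance of every diagonal entry is dominated by the Euclidean distance:
`K_{ii}(u, u) - 2 K_{ii}(u, v) + K_{ii}(v, v) ≤ N ^ 2 |u - v| ^ 2` for some constant `N`. -/
def KernelLipschitz : Prop :=
  ∃ N : ℝ, ∀ (i : Fin d) (u v : EuclideanSpace ℝ (Fin d)),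
    kernelEntry H i i u u - 2 * kernelEntry H i i u v + kernelEntry H i i v v
      ≤ N ^ 2 * ‖u - v‖ ^ 2

end Kernel

section Euler

variable {E : Type*} [NormedAddCommGroup E] [NormedSpace ℝ E]

/-- The Euler iterates `z_0 = x₀`, `z_{l+1} = z_l + h f(z_l)`. -/
def eulerPoint (f : E → E) (x₀ : E) (h : ℝ) : ℕ → E
  | 0 => x₀
  | l + 1 => eulerPoint f x₀ h l + h • f (eulerPoint f x₀ h l)

/-- The Euler approximation as a function of time: the linear interpolation of the points
`(l h, z_l)`, where `z` are the Euler iterates with step `h`. -/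
def eulerPath (f : E → E) (x₀ : E) (h : ℝ) (t : ℝ) : E :=
  eulerPoint f x₀ h ⌊t / h⌋₊ +
    (t / h - ⌊t / h⌋₊) • (eulerPoint f x₀ h (⌊t / h⌋₊ + 1) - eulerPoint f x₀ h ⌊t / h⌋₊)

/-- At a grid time `l h` the Euler approximation is the Euler iterate `z_l`. -/
theorem eulerPath_grid (f : E → E) (x₀ : E) {h : ℝ} (hh : 0 < h) (l : ℕ) :
    eulerPath f x₀ h (l * h) = eulerPoint f x₀ h l := by
  have : (l : ℝ) * h / h = l := by field_simp
  simp [eulerPath, this]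

/-- The weighted discrete squared error `∑ (t_{j+1} - t_j) |x(t_j) - w_j| ^ 2` of a trajectory `x`
with respect to values `w_j` prescribed at the times `t_j`. -/
def weightedLoss {m : ℕ} (t : Fin (m + 1) → ℝ) (x : ℝ → E) (w : Fin m → E) : ℝ :=
  ∑ j : Fin m, (t j.succ - t j.castSucc) * ‖x (t j.castSucc) - w j‖ ^ 2

end Euler

/-- `(f, x₀)` is a solution of the Euler-constrained least-squares problem for the observations
`y`: it minimizes the weighted loss of the Euler approximation subject to
`‖g - f₀‖ ≤ R` and `|z₀| ≤ r`. -/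
structure IsEulerEstimator {d : ℕ} {H : Type*} [NormedAddCommGroup H] [InnerProductSpace ℝ H]
    [RKHS ℝ H (EuclideanSpace ℝ (Fin d)) (EuclideanSpace ℝ (Fin d))]
    (f₀ : H) (R r h : ℝ) {m : ℕ} (t : Fin (m + 1) → ℝ) (y : Fin m → EuclideanSpace ℝ (Fin d))
    (f : H) (x₀ : EuclideanSpace ℝ (Fin d)) : Prop where
  field_mem : ‖f - f₀‖ ≤ R
  init_mem : ‖x₀‖ ≤ r
  le_of_mem : ∀ (g : H) (z₀ : EuclideanSpace ℝ (Fin d)), ‖g - f₀‖ ≤ R → ‖z₀‖ ≤ r →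
    weightedLoss t (eulerPath f x₀ h) y ≤ weightedLoss t (eulerPath g z₀ h) y

end

/-! Minimality against the feasible pair of the true field and initial point bounds the loss by the
Euler error of the true field, of order `h ^ 2` (Grönwall, `norm_eulerPath_sub_solution_le`), plus
twice a sum of inner products of path differences with weighted noise (`weightedLoss_le_add_noise`).
The fitted path depends on the noise, but no covering argument is needed. On an RKHS ball all fields
share a Lipschitz constant, so all feasible Euler paths share a Lipschitz constant and an endpoint
bound. Summation by parts (`sum_inner_le_sum_norm_prefix`) then leaves a weighted sum of norms of
partial noise sums, free of the estimator. These partial sums are dependent but sub-Gaussian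
coordinatewise. Jensen's inequality replaces a union bound over times
(`measureReal_le_sum_mul_abs_le`); the total weight is bounded independently of `m`, so no logarithm
of `m` appears. -/

section RKHSBounds

/-! ### Uniform Lipschitz bounds on RKHS balls -/

variable {d : ℕ} {H : Type*} [NormedAddCommGroup H] [InnerProductSpace ℝ H] [CompleteSpace H]
  [RKHS ℝ H (EuclideanSpace ℝ (Fin d)) (EuclideanSpace ℝ (Fin d))]

theorem kernelEntry_eq_inner_kerFun (i j : Fin d) (x y : EuclideanSpace ℝ (Fin d)) :
    kernelEntry H i j x y =
      inner ℝ (RKHS.kerFun H x (EuclideanSpace.single i (1 : ℝ)))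
        (RKHS.kerFun H y (EuclideanSpace.single j (1 : ℝ))) := by
  rw [kernelEntry, RKHS.kerFun_inner, RKHS.kerFun_apply]

/-- The kernel distance is the distance of the kernel functions. -/
theorem norm_kerFun_single_sub_sq (i : Fin d) (u v : EuclideanSpace ℝ (Fin d)) :
    ‖RKHS.kerFun H u (EuclideanSpace.single i (1 : ℝ))
        - RKHS.kerFun H v (EuclideanSpace.single i (1 : ℝ))‖ ^ 2 =
      kernelEntry H i i u u - 2 * kernelEntry H i i u v + kernelEntry H i i v v := by
  rw [norm_sub_sq_real, kernelEntry_eq_inner_kerFun, kernelEntry_eq_inner_kerFun,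
    kernelEntry_eq_inner_kerFun, real_inner_self_eq_norm_sq, real_inner_self_eq_norm_sq]

theorem norm_le_sum_abs (x : EuclideanSpace ℝ (Fin d)) : ‖x‖ ≤ ∑ i, |x i| := by
  rw [EuclideanSpace.norm_eq]
  refine Real.sqrt_le_iff.2 ⟨Finset.sum_nonneg fun i _ => abs_nonneg _, ?_⟩
  simp only [Real.norm_eq_abs]
  exact Finset.sum_sq_le_sq_sum_of_nonneg fun i _ => abs_nonneg _

/-- Elements of a ball of the RKHS are Lipschitz with a common constant. -/
theorem KernelLipschitz.norm_sub_le {N : ℝ}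
    (hN : ∀ (i : Fin d) (u v : EuclideanSpace ℝ (Fin d)),
      kernelEntry H i i u u - 2 * kernelEntry H i i u v + kernelEntry H i i v v
        ≤ N ^ 2 * ‖u - v‖ ^ 2) (f : H) (u v : EuclideanSpace ℝ (Fin d)) :
    ‖f u - f v‖ ≤ d * |N| * ‖f‖ * ‖u - v‖ := by
  have key (i : Fin d) : |(f u - f v) i| ≤ |N| * ‖f‖ * ‖u - v‖ := by
    have h1 : (f u - f v) i = inner ℝ (RKHS.kerFun H u (EuclideanSpace.single i (1 : ℝ))
        - RKHS.kerFun H v (EuclideanSpace.single i (1 : ℝ))) f := by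
      rw [inner_sub_left, RKHS.kerFun_inner, RKHS.kerFun_inner]
      simp [EuclideanSpace.inner_single_left]
    have h2 : ‖RKHS.kerFun H u (EuclideanSpace.single i (1 : ℝ))
        - RKHS.kerFun H v (EuclideanSpace.single i (1 : ℝ))‖ ≤ |N| * ‖u - v‖ := by
      refine abs_le_of_sq_le_sq' ?_ (by positivity) |>.2
      rw [norm_kerFun_single_sub_sq, mul_pow, sq_abs]
      exact hN i u v
    rw [h1]
    calc _ ≤ _ := abs_real_inner_le_norm _ _
      _ ≤ |N| * ‖u - v‖ * ‖f‖ := by gcongr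
      _ = _ := by ring
  calc ‖f u - f v‖ ≤ ∑ i, |(f u - f v) i| := norm_le_sum_abs _
    _ ≤ ∑ _i : Fin d, |N| * ‖f‖ * ‖u - v‖ := Finset.sum_le_sum fun i _ => key i
    _ = _ := by simp; ring

theorem KernelLipschitz.exists_bounds (hLip : KernelLipschitz H) {S : ℝ} (hS : 0 ≤ S) :
    ∃ Λ F : ℝ, 0 < Λ ∧ 0 ≤ F ∧ ∀ f : H, ‖f‖ ≤ S →
      (∀ u v, ‖f u - f v‖ ≤ Λ * ‖u - v‖) ∧ ‖f 0‖ ≤ F := by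
  obtain ⟨N, hN⟩ := hLip
  -- The `+ 1` makes the Lipschitz constant positive, as the later Grönwall bound divides by it.
  refine ⟨d * |N| * S + 1, S * √‖RKHS.kernel H (0 : EuclideanSpace ℝ (Fin d)) 0‖,
    by positivity, by positivity, fun f hf => ⟨fun u v => ?_, ?_⟩⟩
  · refine (KernelLipschitz.norm_sub_le hN f u v).trans ?_
    gcongr
    calc d * |N| * ‖f‖ ≤ d * |N| * S := by gcongr
      _ ≤ _ := by linarith
  · refine (RKHS.norm_apply_le f 0).trans ?_
    gcongr

end RKHSBounds

/-! ### A priori bounds and convergence of the Euler method -/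

section EulerBounds

variable {E : Type*} [NormedAddCommGroup E] [NormedSpace ℝ E]

theorem eulerPath_eq (f : E → E) (x₀ : E) {h : ℝ} (hh : 0 < h) (t : ℝ) :
    eulerPath f x₀ h t = eulerPoint f x₀ h ⌊t / h⌋₊ +
      (t - ⌊t / h⌋₊ * h) • f (eulerPoint f x₀ h ⌊t / h⌋₊) := by
  rw [eulerPath, eulerPoint, add_sub_cancel_left, smul_smul]
  congr 2
  field_simp

theorem eulerPath_zero (f : E → E) (x₀ : E) (h : ℝ) : eulerPath f x₀ h 0 = x₀ := by
  simp [eulerPath, eulerPoint]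

theorem natFloor_div_mul_le {h t : ℝ} (hh : 0 < h) (ht : 0 ≤ t) : ⌊t / h⌋₊ * h ≤ t := by
  have := Nat.floor_le (div_nonneg ht hh.le)
  rwa [le_div_iff₀ hh] at this

theorem lt_natFloor_div_add_one_mul {h : ℝ} (t : ℝ) (hh : 0 < h) : t < (⌊t / h⌋₊ + 1) * h := by
  have := Nat.lt_floor_add_one (t / h)
  rwa [div_lt_iff₀ hh] at this

/-- Discrete Grönwall: a step multiplies the norm by at most `1 + h * Λ ≤ exp (h * Λ)` and adds at
most `h * F`, whatever the size of `h`. -/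
theorem norm_eulerPoint_le {f : E → E} {x₀ : E} {h Λ F r : ℝ} (hh : 0 ≤ h) (hΛ : 0 ≤ Λ)
    (hF : 0 ≤ F) (hf : ∀ u v, ‖f u - f v‖ ≤ Λ * ‖u - v‖) (hf0 : ‖f 0‖ ≤ F)
    (hx₀ : ‖x₀‖ ≤ r) (l : ℕ) :
    ‖eulerPoint f x₀ h l‖ ≤ (r + l * h * F) * Real.exp (Λ * (l * h)) := by
  induction l with
  | zero => simpa [eulerPoint] using hx₀
  | succ l ih =>
    set z := eulerPoint f x₀ h l
    have h1 : ‖f z‖ ≤ Λ * ‖z‖ + F := by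
      have := hf z 0
      have h2 := norm_sub_norm_le (f z) (f 0)
      rw [sub_zero] at this
      linarith
    have h3 : ‖eulerPoint f x₀ h (l + 1)‖ ≤ (h * Λ + 1) * ‖z‖ + h * F := by
      calc ‖z + h • f z‖ ≤ ‖z‖ + h * ‖f z‖ := by
            refine (norm_add_le _ _).trans ?_
            rw [norm_smul, Real.norm_of_nonneg hh]
        _ ≤ ‖z‖ + h * (Λ * ‖z‖ + F) := by gcongr
        _ = _ := by ring
    have h4 : 1 ≤ Real.exp (Λ * (↑(l + 1) * h)) := Real.one_le_exp (by positivity)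
    have h5 : Real.exp (h * Λ) * Real.exp (Λ * (l * h)) = Real.exp (Λ * (↑(l + 1) * h)) := by
      rw [← Real.exp_add]; push_cast; ring_nf
    calc _ ≤ _ := h3
      _ ≤ Real.exp (h * Λ) * ((r + l * h * F) * Real.exp (Λ * (l * h))) + h * F * 1 := by
          rw [mul_one]
          gcongr
          exact Real.add_one_le_exp _
      _ = (r + l * h * F) * Real.exp (Λ * (↑(l + 1) * h)) + h * F * 1 := by rw [← h5]; ring
      _ ≤ (r + l * h * F) * Real.exp (Λ * (↑(l + 1) * h))
          + h * F * Real.exp (Λ * (↑(l + 1) * h)) := by gcongr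
      _ = _ := by push_cast; ring

theorem norm_eulerPoint_le_of_mul_le {f : E → E} {x₀ : E} {h Λ F r T : ℝ} (hh : 0 ≤ h)
    (hΛ : 0 ≤ Λ) (hF : 0 ≤ F) (hr : 0 ≤ r) (hf : ∀ u v, ‖f u - f v‖ ≤ Λ * ‖u - v‖)
    (hf0 : ‖f 0‖ ≤ F) (hx₀ : ‖x₀‖ ≤ r) {l : ℕ} (hl : l * h ≤ T) :
    ‖eulerPoint f x₀ h l‖ ≤ (r + T * F) * Real.exp (Λ * T) := by
  have : 0 ≤ T := le_trans (by positivity) hl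
  refine (norm_eulerPoint_le hh hΛ hF hf hf0 hx₀ l).trans ?_
  gcongr

/-- If the slopes of an Euler path are bounded by `B` up to time `T`, the path is `B`-Lipschitz
on `[0, T]`. -/
theorem norm_eulerPath_sub_le {f : E → E} {x₀ : E} {h B T : ℝ} (hh : 0 < h)
    (hB : ∀ l : ℕ, l * h ≤ T → ‖f (eulerPoint f x₀ h l)‖ ≤ B) {s t : ℝ} (hs : 0 ≤ s)
    (hst : s ≤ t) (ht : t ≤ T) :
    ‖eulerPath f x₀ h t - eulerPath f x₀ h s‖ ≤ B * (t - s) := by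
  have hsl := natFloor_div_mul_le hh hs
  have hsu := lt_natFloor_div_add_one_mul s hh
  have htl := natFloor_div_mul_le hh (hs.trans hst)
  have hle : ⌊s / h⌋₊ ≤ ⌊t / h⌋₊ := Nat.floor_mono (by gcongr)
  rw [eulerPath_eq f x₀ hh, eulerPath_eq f x₀ hh]
  generalize ⌊s / h⌋₊ = k at *
  generalize ⌊t / h⌋₊ = l at *
  have step {c : ℝ} (hc : 0 ≤ c) {n : ℕ} (hn : n * h ≤ T) :
      ‖c • f (eulerPoint f x₀ h n)‖ ≤ B * c := by
    rw [norm_smul, Real.norm_of_nonneg hc, mul_comm]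
    gcongr
    exact hB n hn
  rcases hle.eq_or_lt with rfl | hlt
  · rw [add_sub_add_left_eq_sub, ← sub_smul]
    refine (step (by linarith) (by linarith)).trans (le_of_eq (by ring))
  -- Split at the first grid point after `s` and the last one before `t`: whole cells by induction,
  -- the two partial cells by `step`.
  · have grid (n : ℕ) (hn : k + 1 + n ≤ l) :
        ‖eulerPoint f x₀ h (k + 1 + n) - eulerPoint f x₀ h (k + 1)‖ ≤ B * (n * h) := by
      induction n with
      | zero => simp
      | succ n ih =>
        have h1 : ((k + 1 + n : ℕ) : ℝ) * h ≤ T := by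
          refine le_trans ?_ (htl.trans ht)
          gcongr
          omega
        have : eulerPoint f x₀ h (k + 1 + (n + 1)) - eulerPoint f x₀ h (k + 1) =
            (eulerPoint f x₀ h (k + 1 + n) - eulerPoint f x₀ h (k + 1)) +
              h • f (eulerPoint f x₀ h (k + 1 + n)) := by
          rw [← add_assoc, eulerPoint]; abel
        rw [this]
        refine (norm_add_le _ _).trans ?_
        have := ih (by omega)
        have := step hh.le h1
        push_cast
        linarith
    obtain ⟨n, rfl⟩ := Nat.exists_eq_add_of_le (Nat.succ_le_of_lt hlt)
    have h1 := grid n le_rfl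
    have h2 := step (c := t - ↑(k + 1 + n) * h) (by linarith) (n := k + 1 + n) (by linarith)
    have h3 := step (c := (k + 1) * h - s) (by linarith) (n := k) (by linarith)
    have : eulerPoint f x₀ h (k + 1 + n) +
          (t - ↑(k + 1 + n) * h) • f (eulerPoint f x₀ h (k + 1 + n)) -
        (eulerPoint f x₀ h k + (s - k * h) • f (eulerPoint f x₀ h k)) =
        (eulerPoint f x₀ h (k + 1 + n) - eulerPoint f x₀ h (k + 1)) +
        (t - ↑(k + 1 + n) * h) • f (eulerPoint f x₀ h (k + 1 + n)) +
        ((k + 1) * h - s) • f (eulerPoint f x₀ h k) := by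
      rw [eulerPoint]; module
    rw [Nat.succ_eq_add_one, this]
    refine (norm_add₃_le).trans ?_
    push_cast at h2 ⊢
    linarith

theorem hasDerivWithinAt_eulerPath (f : E → E) (x₀ : E) {h : ℝ} (hh : 0 < h) {t : ℝ}
    (ht : 0 ≤ t) :
    HasDerivWithinAt (eulerPath f x₀ h) (f (eulerPoint f x₀ h ⌊t / h⌋₊)) (Set.Ici t) t := by
  have h1 := ((((hasDerivAt_id t).sub_const (⌊t / h⌋₊ * h)).smul_const
    (f (eulerPoint f x₀ h ⌊t / h⌋₊))).const_add
      (eulerPoint f x₀ h ⌊t / h⌋₊)).hasDerivWithinAt (s := Set.Ici t)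
  rw [one_smul] at h1
  refine h1.congr_of_eventuallyEq ?_ (eulerPath_eq f x₀ hh t)
  filter_upwards [Ico_mem_nhdsGE (lt_natFloor_div_add_one_mul t hh)] with s hs
  have : ⌊s / h⌋₊ = ⌊t / h⌋₊ := by
    rw [Nat.floor_eq_iff (div_nonneg (ht.trans hs.1) hh.le), le_div_iff₀ hh, div_lt_iff₀ hh]
    exact ⟨(natFloor_div_mul_le hh ht).trans hs.1, hs.2⟩
  rw [eulerPath_eq f x₀ hh, this]
  rfl

/-- Convergence of the Euler method at first order, for steps of any size. -/
theorem norm_eulerPath_sub_solution_le {f : E → E} {x : ℝ → E} {h B Λ T : ℝ} (hh : 0 < h)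
    (hΛ : 0 < Λ) (hf : ∀ u v, ‖f u - f v‖ ≤ Λ * ‖u - v‖)
    (hB : ∀ l : ℕ, l * h ≤ T → ‖f (eulerPoint f (x 0) h l)‖ ≤ B)
    (hx : ∀ s ∈ Set.Icc 0 T, HasDerivWithinAt x (f (x s)) (Set.Icc 0 T) s)
    {t : ℝ} (ht : t ∈ Set.Icc 0 T) :
    ‖eulerPath f (x 0) h t - x t‖ ≤ h * (B * Real.exp (Λ * T)) := by
  have hlip : LipschitzWith Λ.toNNReal f := by
    refine LipschitzWith.of_dist_le_mul fun u v => ?_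
    rw [dist_eq_norm, dist_eq_norm, Real.coe_toNNReal _ hΛ.le]
    exact hf u v
  have hB0 : 0 ≤ B := (norm_nonneg _).trans (hB 0 (by simpa using ht.1.trans ht.2))
  have hpath : LipschitzOnWith B.toNNReal (eulerPath f (x 0) h) (Set.Icc 0 T) := by
    refine LipschitzOnWith.of_dist_le_mul fun u hu v hv => ?_
    rw [Real.coe_toNNReal _ hB0]
    rcases le_total u v with huv | huv
    · rw [dist_comm, dist_eq_norm, Real.dist_eq, abs_sub_comm, abs_of_nonneg (by linarith)]
      exact norm_eulerPath_sub_le hh hB hu.1 huv hv.2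
    · rw [dist_eq_norm, Real.dist_eq, abs_of_nonneg (by linarith)]
      exact norm_eulerPath_sub_le hh hB hv.1 huv hu.2
  -- The path's slope is frozen at the last grid point, at distance at most `B * h`; hence its
  -- defect in the equation is at most `Λ * (B * h)`.
  have key := dist_le_of_approx_trajectories_ODE (v := fun _ => f) (K := Λ.toNNReal)
    (f := eulerPath f (x 0) h) (g := x) (a := 0) (b := T)
    (f' := fun s => f (eulerPoint f (x 0) h ⌊s / h⌋₊)) (g' := fun s => f (x s))
    (εf := Λ * (B * h)) (εg := 0) (δ := 0) (fun _ => hlip) hpath.continuousOn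
    (fun s hs => hasDerivWithinAt_eulerPath f (x 0) hh hs.1)
    (fun s hs => by
      rw [dist_comm, dist_eq_norm]
      refine (hf _ _).trans ?_
      have h1 := natFloor_div_mul_le hh hs.1
      have h2 := lt_natFloor_div_add_one_mul s hh
      have h3 := hB ⌊s / h⌋₊ (h1.trans hs.2.le)
      rw [eulerPath_eq f (x 0) hh, add_sub_cancel_left, norm_smul,
        Real.norm_of_nonneg (by linarith), mul_comm B h]
      gcongr
      linarith)
    (fun s hs => (hx s hs).continuousWithinAt)
    (fun s hs => (hx s ⟨hs.1, hs.2.le⟩).mono_of_mem_nhdsWithin (Icc_mem_nhdsGE_of_mem hs))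
    (fun s _ => by simp) (by simp [eulerPath_zero]) t ht
  rw [dist_eq_norm, Real.coe_toNNReal _ hΛ.le, gronwallBound_of_K_ne_0 hΛ.ne'] at key
  refine key.trans ?_
  have : Real.exp (Λ * (t - 0)) ≤ Real.exp (Λ * T) := by
    rw [sub_zero]; gcongr; exact ht.2
  calc _ = B * h * (Real.exp (Λ * (t - 0)) - 1) := by field_simp; ring
    _ ≤ B * h * Real.exp (Λ * T) := by gcongr; linarith
    _ = _ := by ring

end EulerBounds

/-! ### Abel summation -/

section SummationByParts

variable {E : Type*} [NormedAddCommGroup E] [InnerProductSpace ℝ E]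

theorem sum_inner_eq_sum_inner_sub_prefix {m : ℕ} (x : Fin (m + 1) → E) (v : Fin m → E) :
    ∑ j : Fin m, inner ℝ (x j.castSucc) (v j) =
      ∑ k : Fin m, inner ℝ (x k.castSucc - x k.succ) (∑ j ∈ Finset.Iic k, v j) +
        inner ℝ (x (Fin.last m)) (∑ j, v j) := by
  have hIic {n : ℕ} (v : Fin n → E) (k : Fin n) :
      ∑ j ∈ Finset.Iic k, v j = ∑ j, if j ≤ k then v j else 0 := by
    rw [← Finset.sum_filter]; congr 1; ext; simp
  simp only [hIic]
  induction m with
  | zero => simp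
  | succ m ih =>
    rw [Fin.sum_univ_castSucc, ih (fun i => x i.castSucc) (fun j => v j.castSucc),
      Fin.sum_univ_castSucc (f := fun k : Fin (m + 1) => inner ℝ (x k.castSucc - x k.succ) _)]
    have h1 : ∀ j : Fin (m + 1), j ≤ Fin.last m := Fin.le_last
    have h2 : ∀ k : Fin m, ¬ Fin.last m ≤ k.castSucc := fun k => not_le.2 (Fin.castSucc_lt_last k)
    simp only [Fin.sum_univ_castSucc (n := m), h1, h2, if_true, if_false, add_zero,
      Fin.castSucc_le_castSucc_iff, Fin.succ_castSucc, Fin.succ_last, inner_sub_left,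
      inner_add_right]
    ring

/-- The bound sees `x` only through `B` and `D`, so it holds for all such paths at once, even ones
chosen after seeing `v`. -/
theorem sum_inner_le_sum_norm_prefix {m : ℕ} {w : Fin m → ℝ} {B D : ℝ} {x : Fin (m + 1) → E}
    (hx : ∀ k : Fin m, ‖x k.castSucc - x k.succ‖ ≤ B * w k) (hlast : ‖x (Fin.last m)‖ ≤ D)
    (v : Fin m → E) :
    ∑ j : Fin m, inner ℝ (x j.castSucc) (v j) ≤
      ∑ k : Fin m, B * w k * ‖∑ j ∈ Finset.Iic k, v j‖ + D * ‖∑ j, v j‖ := by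
  rw [sum_inner_eq_sum_inner_sub_prefix]
  gcongr with k
  · refine (real_inner_le_norm _ _).trans ?_
    gcongr
    exact hx k
  · refine (real_inner_le_norm _ _).trans ?_
    gcongr

end SummationByParts

/-! ### Sub-Gaussian tails -/

section Concentration

variable {Ω : Type*} {mΩ : MeasurableSpace Ω} {μ : Measure Ω}

/-- Jensen's inequality for the exponential of a weighted sum of absolute values. -/
theorem exp_sum_mul_abs_le {ι : Type*} (s : Finset ι) {a : ι → ℝ} {A : ℝ} (hA : 0 < A)
    (ha : ∀ k ∈ s, 0 ≤ a k) (hsum : ∑ k ∈ s, a k ≤ A) (y : ι → ℝ) (c : ℝ) :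
    Real.exp (c * ∑ k ∈ s, a k * |y k|) ≤
      (1 - ∑ k ∈ s, a k / A) +
        ∑ k ∈ s, a k / A * (Real.exp (c * A * y k) + Real.exp (-(c * A) * y k)) := by
  have hw : ∑ k ∈ s, a k / A ≤ 1 := by
    rw [← Finset.sum_div, div_le_one hA]; exact hsum
  -- The mass missing from the weights `a k / A` is placed at the point `0`.
  have h := (convexOn_exp).map_add_sum_le (t := s) (w := fun k => a k / A)
    (p := fun k => c * A * |y k|) (v := 1 - ∑ k ∈ s, a k / A) (q := 0)
    (fun k hk => div_nonneg (ha k hk) hA.le) (by ring) (fun _ _ => Set.mem_univ _)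
    (by linarith) (Set.mem_univ _)
  simp only [smul_eq_mul, mul_zero, zero_add, Real.exp_zero, mul_one] at h
  have hlhs : ∑ k ∈ s, a k / A * (c * A * |y k|) = c * ∑ k ∈ s, a k * |y k| := by
    rw [Finset.mul_sum]
    refine Finset.sum_congr rfl fun k _ => ?_
    field_simp
  rw [hlhs] at h
  refine h.trans ?_
  gcongr with k hk
  · exact div_nonneg (ha k hk) hA.le
  · rcases abs_cases (y k) with ⟨h1, -⟩ | ⟨h1, -⟩ <;> rw [h1]
    · exact le_add_of_nonneg_right (Real.exp_pos _).le
    · rw [mul_neg, ← neg_mul]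
      exact le_add_of_nonneg_left (Real.exp_pos _).le

/-- A weighted sum of absolute values of (dependent) sub-Gaussian variables has a sub-Gaussian
tail. -/
theorem measureReal_le_sum_mul_abs_le [IsProbabilityMeasure μ] {ι : Type*} (s : Finset ι)
    {a : ι → ℝ} {A σ : ℝ} (hA : 0 < A) (hσ : 0 < σ) (ha : ∀ k ∈ s, 0 ≤ a k)
    (hsum : ∑ k ∈ s, a k ≤ A) {X : ι → Ω → ℝ}
    (hint : ∀ k ∈ s, ∀ c : ℝ, Integrable (fun ω => Real.exp (c * X k ω)) μ)
    (hmgf : ∀ k ∈ s, ∀ c : ℝ, mgf (X k) μ c ≤ Real.exp (σ ^ 2 * c ^ 2 / 2)) {u : ℝ}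
    (hu : 0 ≤ u) :
    μ.real {ω | u ≤ ∑ k ∈ s, a k * |X k ω|} ≤ 2 * Real.exp (-u ^ 2 / (2 * A ^ 2 * σ ^ 2)) := by
  -- Minimizer of the Chernoff exponent `-c * u + σ ^ 2 * (c * A) ^ 2 / 2`.
  set c : ℝ := u / (A ^ 2 * σ ^ 2)
  have hc : 0 ≤ c := by positivity
  set Z : Ω → ℝ := fun ω => ∑ k ∈ s, a k * |X k ω|
  set Y : Ω → ℝ := fun ω => (1 - ∑ k ∈ s, a k / A) +
    ∑ k ∈ s, a k / A * (Real.exp (c * A * X k ω) + Real.exp (-(c * A) * X k ω))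
  have hle (ω : Ω) : Real.exp (c * Z ω) ≤ Y ω := exp_sum_mul_abs_le s hA ha hsum (X · ω) c
  have hYs (k : ι) (hk : k ∈ s) : Integrable (fun ω => a k / A *
      (Real.exp (c * A * X k ω) + Real.exp (-(c * A) * X k ω))) μ :=
    ((hint k hk _).add (hint k hk _)).const_mul _
  have hYint : Integrable Y μ := (integrable_const _).add (integrable_finsetSum s hYs)
  have hXm (k : ι) (hk : k ∈ s) : AEMeasurable (X k) μ :=
    aemeasurable_of_integrable_exp_mul one_ne_zero.symm
      (by simp) (hint k hk 1)
  have hZint : Integrable (fun ω => Real.exp (c * Z ω)) μ := by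
    refine hYint.mono' ?_ (Filter.Eventually.of_forall fun ω => ?_)
    · refine (Real.measurable_exp.comp_aemeasurable ?_).aestronglyMeasurable
      refine AEMeasurable.const_mul (Finset.aemeasurable_fun_sum s fun k hk => ?_) _
      exact ((continuous_abs.measurable).comp_aemeasurable (hXm k hk)).const_mul _
    · rw [Real.norm_of_nonneg (Real.exp_pos _).le]; exact hle ω
  set G : ℝ := Real.exp (σ ^ 2 * (c * A) ^ 2 / 2)
  have hG1 : 1 ≤ G := Real.one_le_exp (by positivity)
  have hmgfZ : mgf Z μ c ≤ 2 * G := by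
    calc mgf Z μ c ≤ ∫ ω, Y ω ∂μ := integral_mono hZint hYint hle
      _ = (1 - ∑ k ∈ s, a k / A) +
          ∑ k ∈ s, a k / A * (mgf (X k) μ (c * A) + mgf (X k) μ (-(c * A))) := by
        simp only [Y]
        rw [integral_add (integrable_const _) (integrable_finsetSum s hYs),
          integral_finsetSum s hYs]
        simp only [integral_const, probReal_univ, one_smul]
        congr 1
        refine Finset.sum_congr rfl fun k hk => ?_
        rw [integral_const_mul, integral_add (hint k hk _) (hint k hk _)]
        rfl
      _ ≤ (1 - ∑ k ∈ s, a k / A) * (2 * G) + ∑ k ∈ s, a k / A * (2 * G) := by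
        have hw : ∑ k ∈ s, a k / A ≤ 1 := by
          rw [← Finset.sum_div, div_le_one hA]; exact hsum
        gcongr with k hk
        · nlinarith
        · exact div_nonneg (ha k hk) hA.le
        · have h1 := hmgf k hk (c * A)
          have h2 := hmgf k hk (-(c * A))
          rw [neg_sq] at h2
          linarith
      _ = 2 * G := by rw [← Finset.sum_mul]; ring
  refine (measure_ge_le_exp_mul_mgf u hc hZint).trans ?_
  calc Real.exp (-c * u) * mgf Z μ c ≤ Real.exp (-c * u) * (2 * G) := by gcongr
    _ = 2 * (Real.exp (-c * u) * G) := by ring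
    _ = _ := by
      rw [← Real.exp_add]
      congr 2
      simp only [c]
      field_simp
      ring

variable {d m : ℕ}

/-- Moment generating functions of the coordinates of weighted sums of centered bounded
independent random vectors. -/
theorem hasSubgaussianMGF_sum_coord [IsProbabilityMeasure μ]
    {ξ : Fin m → Ω → EuclideanSpace ℝ (Fin d)} {M : ℝ} (hmeas : ∀ j, Measurable (ξ j))
    (hind : iIndepFun ξ μ) (hbdd : ∀ j, ∀ᵐ ω ∂μ, ‖ξ j ω‖ ≤ M) (hmean : ∀ j, ∫ ω, ξ j ω ∂μ = 0)
    (w : Fin m → ℝ) (s : Finset (Fin m)) (i : Fin d) :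
    HasSubgaussianMGF (fun ω => (∑ j ∈ s, w j • ξ j ω) i)
      (∑ j ∈ s, ‖w j‖₊ ^ 2 * ‖M‖₊ ^ 2) μ := by
  have hcoord : Measurable fun x : EuclideanSpace ℝ (Fin d) => x i := by fun_prop
  -- Hoeffding's lemma on `[-M, M]`: the proxy is the squared half-length.
  have hM : ‖M - -M‖₊ / 2 = ‖M‖₊ := by
    ext
    simp [← two_mul]
  have hw (j : Fin m) : ‖w j‖₊ ^ 2 = NNReal.mk (w j ^ 2) (sq_nonneg (w j)) :=
    NNReal.eq (by simp)
  have h1 (j : Fin m) : HasSubgaussianMGF (fun ω => ξ j ω i) (‖M‖₊ ^ 2) μ := by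
    rw [← hM]
    refine hasSubgaussianMGF_of_mem_Icc_of_integral_eq_zero
      (hcoord.comp (hmeas j)).aemeasurable ?_ ?_
    · filter_upwards [hbdd j] with ω hω
      exact abs_le.1 ((PiLp.norm_apply_le (ξ j ω) i).trans hω)
    · have hint : Integrable (ξ j) μ :=
        Integrable.of_bound (hmeas j).aestronglyMeasurable M (hbdd j)
      have := (EuclideanSpace.proj (𝕜 := ℝ) i).integral_comp_comm hint
      rw [hmean j, map_zero] at this
      exact this
  have hind' : iIndepFun (fun j ω => w j * ξ j ω i) μ :=
    hind.comp (fun j x => w j * x i) fun j => hcoord.const_mul (w j)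
  have := HasSubgaussianMGF.sum_of_iIndepFun hind' (s := s)
    (c := fun j => ‖w j‖₊ ^ 2 * ‖M‖₊ ^ 2) fun j _ => by
      rw [hw j]
      exact (h1 j).const_mul (w j)
  simpa using this

end Concentration

/-! ### Tails of the partial noise sums -/

section Noise

variable {Ω : Type*} {mΩ : MeasurableSpace Ω} {μ : Measure Ω} {d m : ℕ}

/-- Tail bound for a weighted sum of norms of partial sums of centered bounded independent random
vectors. -/
theorem measureReal_le_sum_mul_norm_sum_le [IsProbabilityMeasure μ]
    {ξ : Fin m → Ω → EuclideanSpace ℝ (Fin d)} {M : ℝ} (hmeas : ∀ j, Measurable (ξ j))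
    (hind : iIndepFun ξ μ) (hbdd : ∀ j, ∀ᵐ ω ∂μ, ‖ξ j ω‖ ≤ M) (hmean : ∀ j, ∫ ω, ξ j ω ∂μ = 0)
    (hM : 0 < M) {w : Fin m → ℝ} (hw : 0 < ∑ j, w j ^ 2) {ι : Type*} [Fintype ι] {a : ι → ℝ}
    {A : ℝ} (ha : ∀ k, 0 ≤ a k) (hA : 0 < A) (hsum : d * ∑ k, a k ≤ A)
    (s : ι → Finset (Fin m)) {u : ℝ} (hu : 0 ≤ u) :
    μ.real {ω | u ≤ ∑ k, a k * ‖∑ j ∈ s k, w j • ξ j ω‖} ≤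
      2 * Real.exp (-u ^ 2 / (2 * A ^ 2 * (M ^ 2 * ∑ j, w j ^ 2))) := by
  have hσ : (M * √(∑ j, w j ^ 2)) ^ 2 = M ^ 2 * ∑ j, w j ^ 2 := by
    rw [mul_pow, Real.sq_sqrt hw.le]
  rw [← hσ]
  refine (measureReal_mono ?_).trans
    -- Norms are bounded by sums over coordinates, so each weight occurs `d` times.
    (measureReal_le_sum_mul_abs_le (Finset.univ : Finset (ι × Fin d)) (a := fun p => a p.1)
      (X := fun p ω => (∑ j ∈ s p.1, w j • ξ j ω) p.2) hA (by positivity) (fun p _ => ha p.1) ?_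
      (fun p _ c => (hasSubgaussianMGF_sum_coord hmeas hind hbdd hmean w (s p.1)
        p.2).integrable_exp_mul c) (fun p _ c => ?_) hu)
  · intro ω hω
    refine le_trans (Set.mem_ofPred.1 hω) ?_
    rw [Fintype.sum_prod_type]
    gcongr with k
    dsimp only
    rw [← Finset.mul_sum]
    exact mul_le_mul_of_nonneg_left (norm_le_sum_abs _) (ha k)
  · rw [Fintype.sum_prod_type]
    simpa [← Finset.mul_sum] using hsum
  -- Every partial sum is given the variance proxy of the full sum.
  · refine ((hasSubgaussianMGF_sum_coord hmeas hind hbdd hmean w (s p.1) p.2).mgf_le c).trans ?_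
    rw [hσ]
    gcongr
    push_cast
    simp only [Real.norm_eq_abs, sq_abs]
    rw [← Finset.sum_mul, mul_comm]
    gcongr
    exact Finset.subset_univ _

end Noise

/-- The basic inequality of least squares. -/
theorem weightedLoss_le_add_noise {E : Type*} [NormedAddCommGroup E] [InnerProductSpace ℝ E]
    {m : ℕ} {t : Fin (m + 1) → ℝ} {x z : ℝ → E} {v e : Fin m → E}
    (hle : weightedLoss t x (fun j => v j + e j) ≤ weightedLoss t z (fun j => v j + e j)) :
    weightedLoss t x v ≤ weightedLoss t z v +
      2 * ∑ j : Fin m, inner ℝ (x (t j.castSucc) - z (t j.castSucc))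
        ((t j.succ - t j.castSucc) • e j) := by
  have expand (y : ℝ → E) : weightedLoss t y (fun j => v j + e j) =
      weightedLoss t y v -
        2 * ∑ j : Fin m, (t j.succ - t j.castSucc) * inner ℝ (y (t j.castSucc) - v j) (e j) +
        ∑ j : Fin m, (t j.succ - t j.castSucc) * ‖e j‖ ^ 2 := by
    simp only [weightedLoss, Finset.mul_sum, ← Finset.sum_sub_distrib, ← Finset.sum_add_distrib]
    refine Finset.sum_congr rfl fun j _ => ?_
    rw [← sub_sub, norm_sub_sq_real]
    ring
  rw [expand, expand] at hle
  have : ∑ j : Fin m, inner ℝ (x (t j.castSucc) - z (t j.castSucc))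
        ((t j.succ - t j.castSucc) • e j) =
      ∑ j : Fin m, (t j.succ - t j.castSucc) * inner ℝ (x (t j.castSucc) - v j) (e j) -
      ∑ j : Fin m, (t j.succ - t j.castSucc) * inner ℝ (z (t j.castSucc) - v j) (e j) := by
    rw [← Finset.sum_sub_distrib]
    refine Finset.sum_congr rfl fun j _ => ?_
    rw [inner_smul_right, ← mul_sub, ← inner_sub_left, sub_sub_sub_cancel_right]
  linarith

/-! ### The oracle inequality -/

set_option maxHeartbeats 2000000 in
theorem mainTheorem5 {d : ℕ} (H : Type*) [NormedAddCommGroup H] [InnerProductSpace ℝ H]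
    [CompleteSpace H] [RKHS ℝ H (EuclideanSpace ℝ (Fin d)) (EuclideanSpace ℝ (Fin d))]
    (hC2 : KernelC2 H) (hLip : KernelLipschitz H)
    (R r T M ρ : ℝ) (hR : 0 ≤ R) (hr : 0 ≤ r) (hT : 0 < T) (hM : 0 ≤ M) (hρ : 0 ≤ ρ) :
    ∃ K₂ L₁₂ L₁₃ : ℝ, 0 < K₂ ∧ 0 < L₁₂ ∧ 0 < L₁₃ ∧
      ∀ (f₀ : H), ‖f₀‖ ≤ ρ →
      -- the true vector field, initial condition and trajectory
      ∀ (fstar : H) (x₀star : EuclideanSpace ℝ (Fin d)) (xstar : ℝ → EuclideanSpace ℝ (Fin d)),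
        ‖fstar - f₀‖ ≤ R → ‖x₀star‖ ≤ r → xstar 0 = x₀star →
        (∀ s ∈ Set.Icc 0 T, HasDerivWithinAt xstar (fstar (xstar s)) (Set.Icc 0 T) s) →
      -- the step size and the observation times, with final time `T`
      ∀ (h : ℝ), 0 < h →
      ∀ (m : ℕ) (t : Fin (m + 1) → ℝ), 0 ≤ t 0 → Monotone t → t (Fin.last m) = T →
      -- the noise
      ∀ (Ω : Type*) [MeasurableSpace Ω] (μ : Measure Ω) [IsProbabilityMeasure μ]
        (ξ : Fin m → Ω → EuclideanSpace ℝ (Fin d)),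
        (∀ j, Measurable (ξ j)) → iIndepFun ξ μ → (∀ j, ∀ᵐ ω ∂μ, ‖ξ j ω‖ ≤ M) →
        (∀ j, ∫ ω, ξ j ω ∂μ = 0) →
      -- the estimator computed from the noisy observations
      ∀ (fhat : Ω → H) (x₀hat : Ω → EuclideanSpace ℝ (Fin d)),
        (∀ᵐ ω ∂μ, IsEulerEstimator f₀ R r h t
          (fun j => xstar (t j.castSucc) + ξ j ω) (fhat ω) (x₀hat ω)) →
      ∀ ε : ℝ, 0 < ε →
        μ {ω | L₁₃ * √(∑ j : Fin m, (t j.succ - t j.castSucc) ^ 2) + h ^ 2 * L₁₂ + ε ≤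
            weightedLoss t (eulerPath (fhat ω) (x₀hat ω) h) (fun j => xstar (t j.castSucc))}
          ≤ ENNReal.ofReal (Real.exp
            (-2 * ε ^ 2 / (K₂ ^ 2 * ∑ j : Fin m, (t j.succ - t j.castSucc) ^ 2))) := by
  obtain ⟨Λ, F, hΛ, hF, hbounds⟩ := hLip.exists_bounds (S := ρ + R) (by positivity)
  set D₀ : ℝ := (r + T * F) * Real.exp (Λ * T)
  have hD₀ : 0 ≤ D₀ := by positivity
  set B : ℝ := Λ * D₀ + F
  have hB : 0 ≤ B := by positivity
  -- The factor 4 combines the 2 of the basic inequality with the two paths being subtracted. The `+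
  -- 1` here covers `d = 0`, and that in `κ` covers `M = 0`.
  set A : ℝ := d * (4 * B * T + 4 * (r + B * T)) + 1
  have hA : 0 < A := by positivity
  set κ : ℝ := A * (M + 1)
  have hκ : 0 < κ := by positivity
  refine ⟨2 * κ, T * (B * Real.exp (Λ * T)) ^ 2 + 1, 2 * κ, by positivity, by positivity,
    by positivity, ?_⟩
  intro f₀ hf₀ fstar x₀star xstar hfstar hx₀star hx0 hode h hh m t ht0 htm htT Ω _ μ _ ξ hmeas
    hind hbdd hmean fhat x₀hat hest ε hε
  have hball {f : H} (hf : ‖f - f₀‖ ≤ R) : ‖f‖ ≤ ρ + R := by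
    have := norm_sub_norm_le f f₀
    linarith
  have hw (j : Fin m) : 0 ≤ t j.succ - t j.castSucc :=
    sub_nonneg.2 (htm (Fin.castSucc_lt_succ).le)
  have htmem (j : Fin (m + 1)) : t j ∈ Set.Icc 0 T :=
    ⟨ht0.trans (htm (Fin.zero_le j)), htT ▸ htm (Fin.le_last j)⟩
  have hwsum : ∑ j : Fin m, (t j.succ - t j.castSucc) ≤ T := by
    have : ∑ j : Fin m, (t j.succ - t j.castSucc) = t (Fin.last m) - t 0 := by
      have := Fin.sum_univ_succ t
      rw [Fin.sum_univ_castSucc] at this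
      rw [Finset.sum_sub_distrib]
      linarith
    linarith
  have slope {f : H} {z : EuclideanSpace ℝ (Fin d)} (hf : ‖f - f₀‖ ≤ R) (hz : ‖z‖ ≤ r) (l : ℕ)
      (hl : l * h ≤ T) : ‖f (eulerPoint f z h l)‖ ≤ B := by
    obtain ⟨hf1, hf2⟩ := hbounds f (hball hf)
    have h1 := norm_eulerPoint_le_of_mul_le hh.le hΛ.le hF hr hf1 hf2 hz hl
    have h2 := hf1 (eulerPoint f z h l) 0
    rw [sub_zero] at h2
    have h3 := norm_sub_norm_le (f (eulerPoint f z h l)) (f 0)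
    have h4 : Λ * ‖eulerPoint f z h l‖ ≤ Λ * D₀ := by gcongr
    linarith
  have path_last {f : H} {z : EuclideanSpace ℝ (Fin d)} (hf : ‖f - f₀‖ ≤ R) (hz : ‖z‖ ≤ r) :
      ‖eulerPath f z h (t (Fin.last m))‖ ≤ r + B * T := by
    have h1 := norm_eulerPath_sub_le hh (slope hf hz) le_rfl hT.le le_rfl
    rw [eulerPath_zero, sub_zero] at h1
    have h2 := norm_sub_norm_le (eulerPath f z h T) z
    rw [htT]
    linarith
  have path_sub {f : H} {z : EuclideanSpace ℝ (Fin d)} (hf : ‖f - f₀‖ ≤ R) (hz : ‖z‖ ≤ r)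
      (k : Fin m) : ‖eulerPath f z h (t k.castSucc) - eulerPath f z h (t k.succ)‖ ≤
        B * (t k.succ - t k.castSucc) := by
    rw [norm_sub_rev]
    exact norm_eulerPath_sub_le hh (slope hf hz) (htmem _).1 (sub_nonneg.1 (hw k)) (htmem _).2
  set w : Fin m → ℝ := fun j => t j.succ - t j.castSucc with hwdef
  rcases (Finset.sum_nonneg fun j (_ : j ∈ Finset.univ) => sq_nonneg (w j)).eq_or_lt with hV | hV
  -- Division by zero gives exponent `0`, so the claimed bound is `1`.
  · refine prob_le_one.trans ?_
    change 1 ≤ ENNReal.ofReal (Real.exp (_ / (_ * ∑ j, w j ^ 2)))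
    simp [← hV]
  -- `none` carries the boundary term of the summation by parts, `some k` the prefix sum up to `k`.
  set a : Option (Fin m) → ℝ := fun k => k.elim (4 * (r + B * T)) fun k => 4 * B * w k
  set s : Option (Fin m) → Finset (Fin m) := fun k => k.elim Finset.univ Finset.Iic
  have herr : weightedLoss t (eulerPath fstar x₀star h) (fun j => xstar (t j.castSucc)) ≤
      h ^ 2 * (T * (B * Real.exp (Λ * T)) ^ 2) := by
    have h1 (j : Fin m) : ‖eulerPath fstar x₀star h (t j.castSucc) - xstar (t j.castSucc)‖ ≤
        h * (B * Real.exp (Λ * T)) := by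
      subst hx0
      exact norm_eulerPath_sub_solution_le hh hΛ (hbounds fstar (hball hfstar)).1
        (slope hfstar hx₀star) hode (htmem _)
    calc _ ≤ ∑ j : Fin m, w j * (h * (B * Real.exp (Λ * T))) ^ 2 := by
          unfold weightedLoss
          gcongr with j
          · exact hw j
          · exact h1 j
      _ = (∑ j, w j) * (h * (B * Real.exp (Λ * T))) ^ 2 := by rw [Finset.sum_mul]
      _ ≤ T * (h * (B * Real.exp (Λ * T))) ^ 2 := by gcongr
      _ = _ := by ring
  set V : ℝ := ∑ j, w j ^ 2
  -- The larger event involves only the noise; monotonicity of the outer measure then requires no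
  -- measurability of the estimator.
  have hsub : {ω | 2 * κ * √V + h ^ 2 * (T * (B * Real.exp (Λ * T)) ^ 2 + 1) + ε ≤
      weightedLoss t (eulerPath (fhat ω) (x₀hat ω) h) (fun j => xstar (t j.castSucc))} ≤ᵐ[μ]
      {ω | 2 * κ * √V + ε ≤ ∑ k, a k * ‖∑ j ∈ s k, w j • ξ j ω‖} := by
    filter_upwards [hest] with ω hω
    intro (hlarge : _ ≤ _)
    have h1 := weightedLoss_le_add_noise (hω.le_of_mem fstar x₀star hfstar hx₀star)
    have h2 := sum_inner_le_sum_norm_prefix (w := w) (B := 2 * B) (D := 2 * (r + B * T))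
      (x := fun k => eulerPath (fhat ω) (x₀hat ω) h (t k) - eulerPath fstar x₀star h (t k))
      (fun k => by
        rw [sub_sub_sub_comm]
        refine (norm_sub_le _ _).trans ?_
        have := path_sub hω.field_mem hω.init_mem k
        have := path_sub hfstar hx₀star k
        simp only [hwdef]
        linarith)
      (by
        refine (norm_sub_le _ _).trans ?_
        have := path_last hω.field_mem hω.init_mem
        have := path_last hfstar hx₀star
        linarith)
      (fun j => w j • ξ j ω)
    have h3 : ∑ k, a k * ‖∑ j ∈ s k, w j • ξ j ω‖ =
        2 * (∑ k : Fin m, 2 * B * w k * ‖∑ j ∈ Finset.Iic k, w j • ξ j ω‖ +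
          2 * (r + B * T) * ‖∑ j, w j • ξ j ω‖) := by
      rw [Fintype.sum_option, mul_add, Finset.mul_sum, add_comm]
      simp only [a, s, Option.elim]
      congr 1
      · exact Finset.sum_congr rfl fun k _ => by ring
      · ring
    change _ ≤ _
    rw [h3]
    have h4 : 0 ≤ h ^ 2 := sq_nonneg h
    simp only [hwdef] at h2 hlarge ⊢
    linarith
  have hasum : d * ∑ k, a k ≤ A := by
    have : ∑ k, a k ≤ 4 * B * T + 4 * (r + B * T) := by
      rw [Fintype.sum_option, add_comm]
      simp only [a, Option.elim]
      rw [← Finset.mul_sum]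
      gcongr
    calc d * ∑ k, a k ≤ d * (4 * B * T + 4 * (r + B * T)) := by gcongr
      _ ≤ A := by simp only [A]; linarith
  have htail := measureReal_le_sum_mul_norm_sum_le hmeas hind
    (fun j => (hbdd j).mono fun ω hω => hω.trans (le_add_of_nonneg_right zero_le_one)) hmean
    (by positivity : 0 < M + 1) hV (a := a)
    (fun k => by
      cases k with
      | none => simp only [a, Option.elim]; positivity
      | some k => exact mul_nonneg (by positivity) (hw k))
    hA hasum s (u := 2 * κ * √V + ε) (by positivity)
  refine (measure_mono_ae hsub).trans ?_
  rw [← ofReal_measureReal]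
  refine ENNReal.ofReal_le_ofReal (htail.trans ?_)
  have hsq : √V ^ 2 = V := Real.sq_sqrt hV.le
  have hexp : 2 * Real.exp (-2) ≤ 1 := by
    rw [Real.exp_neg, ← div_eq_mul_inv, div_le_one (Real.exp_pos _)]
    linarith [Real.add_one_le_exp (2 : ℝ)]
  -- Dropping the cross term of the square, `2 * κ * √V` contributes exactly `-2` to the exponent,
  -- and `exp (-2)` absorbs the prefactor 2.
  calc 2 * Real.exp (-(2 * κ * √V + ε) ^ 2 / (2 * A ^ 2 * ((M + 1) ^ 2 * V)))
      ≤ 2 * Real.exp (-2 + -2 * ε ^ 2 / ((2 * κ) ^ 2 * V)) := by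
        gcongr
        have : -2 + -2 * ε ^ 2 / ((2 * κ) ^ 2 * V) =
            -(4 * κ ^ 2 * V + ε ^ 2) / (2 * A ^ 2 * ((M + 1) ^ 2 * V)) := by
          simp only [κ]; field_simp; ring
        rw [this]
        gcongr
        have : 0 ≤ 4 * κ * √V * ε := by positivity
        nlinarith
    _ = 2 * Real.exp (-2) * Real.exp (-2 * ε ^ 2 / ((2 * κ) ^ 2 * V)) := by
        rw [Real.exp_add]; ring
    _ ≤ _ := mul_le_of_le_one_left (Real.exp_pos _).le hexp
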